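/- All rings are commutative and Noetherian with identity, and modules need not be finitely generated unless stated. A complex $P=(\cdots\to P_{i+1}\to P_i\to P_{i-1}\to\cdots)$, $i\in\mathbb{Z}$, of $R$-modules has $\sup P=\sup\{i\mid P_i\neq 0\}$ and $\operatorname{hsup}P=\sup\{i\mid \operatorname{H}_i(P)\neq 0\}$. A projective resolution of $M$ is a complex $P$ of projective modules with $P_i=0$ for $i<0$, $\operatorname{H}_i(P)=0$ for $i>0$ and $\operatorname{H}_0(P)\cong M$. A quasi-projective resolution of an $R$-module $M$ is a bounded below complex $P$ of projective $R$-modules for which there are non-negative integers $a_i$ $(i\in\mathbb{Z})$, not all zero, such that $\operatorname{H}_i(P)\cong M^{\oplus a_i}$ for all $i$; it is finite if $\sup P<\infty$. For $M\neq 0$, the quasi-projective dimension $\operatorname{qpd}_RM\in\mathbb{N}\cup\{\infty\}$ is the infimum of $\sup P-\operatorname{hsup}P$ over all finite quasi-projective resolutions $P$ of $M$ (and $\infty$ if there are none); for $M=0$ one puts $\operatorname{qpd}_RM=-\infty$. The projective dimension of the zero module is also taken to be $-\infty$. Let $Q$ be a ring, $\boldsymbol{x}=x_1,\dots,x_c$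 a $Q$-regular sequence (so that $(\boldsymbol{x})\neq Q$), $R=Q/(\boldsymbol{x})$, and let $M$ be an $R$-module. (1) If $P$ is a projective resolution of $M$ as a $Q$-module, then $P\otimes_QR$ is a quasi-projective resolution of $M$ as an $R$-module. (2) $\operatorname{qpd}_RM\leqslant\operatorname{pd}_QM$. (3) If $Q$ is a regular local ring and $M$ is finitely generated, then $\operatorname{qpd}_RM\leqslant\operatorname{edim}R$, where $\operatorname{edim}R=\dim_{R/\mathfrak m}\mathfrak m/\mathfrak m^2$ is the embedding dimension of the local ring $R$ with maximal ideal $\mathfrak m$. In particular, $\operatorname{qpd}_RM<\infty$. -/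

import Mathlib

universe u

open CategoryTheory

noncomputable section

namespace QuasiProjective

/-- A `ℤ`-graded complex `P` (with differentials `P.X i ⟶ P.X (i - 1)`) is a projective resolution
of the `R`-module `M`: it consists of projective modules, is concentrated in nonnegative degrees,
is exact in positive degrees, and its homology in degree `0` is isomorphic to `M`. -/
structure IsProjectiveResolution {R : Type u} [CommRing R] (M : ModuleCat.{u} R)
    (P : ChainComplex (ModuleCat.{u} R) ℤ) : Prop where
  projective : ∀ i : ℤ, Module.Projective R (P.X i)
  subsingleton_of_neg : ∀ i : ℤ, i < 0 → Subsingleton (P.X i)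
  exact_of_pos : ∀ i : ℤ, 0 < i → Subsingleton (P.homology i)
  homology_zero : Nonempty (P.homology 0 ≃ₗ[R] M)

/-- A quasi-projective resolution of the `R`-module `M`: a bounded below complex `P` of projective
`R`-modules such that there are nonnegative integers `a i`, not all zero, with
`H_i(P) ≅ M ^ (a i)` for all `i`. (In degrees `i < inf P` the homology vanishes: there the condition
forces `a i = 0` if `M ≠ 0`, and is void if `M = 0`. So the zero complex is a quasi-projective
resolution of the zero module, and of no other module.) -/
structure IsQuasiProjectiveResolution {R : Type u} [CommRing R] (M : ModuleCat.{u} R)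
    (P : ChainComplex (ModuleCat.{u} R) ℤ) : Prop where
  projective : ∀ i : ℤ, Module.Projective R (P.X i)
  boundedBelow : ∃ n : ℤ, ∀ i : ℤ, i < n → Subsingleton (P.X i)
  homology_eq : ∃ a : ℤ → ℕ, (∃ i, a i ≠ 0) ∧
    ∀ i : ℤ, Nonempty (P.homology i ≃ₗ[R] (Fin (a i) → M))

/-- `s = sup P`, the supremum `s` of the degrees `i` with `P_i ≠ 0` being an integer: this says in
particular that `P` is nonzero and bounded above. -/
def IsSup {R : Type u} [CommRing R] (P : ChainComplex (ModuleCat.{u} R) ℤ) (s : ℤ) : Prop :=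
  IsGreatest {i : ℤ | Nontrivial (P.X i)} s

/-- `h = hsup P`, the supremum `h` of the degrees `i` with `H_i(P) ≠ 0` being an integer. -/
def IsHSup {R : Type u} [CommRing R] (P : ChainComplex (ModuleCat.{u} R) ℤ) (h : ℤ) : Prop :=
  IsGreatest {i : ℤ | Nontrivial (P.homology i)} h

open Classical in
/-- The quasi-projective dimension of the `R`-module `M`: it is `-∞` (that is, `⊥`) if `M = 0`, and
otherwise the infimum of `sup P - hsup P` over all finite quasi-projective resolutions `P` of `M`
(`⊤` if there are none). If `M ≠ 0`, then `sup P` and `hsup P` are integers with `hsup P ≤ sup P`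
for every finite quasi-projective resolution `P`. -/
def qpd {R : Type u} [CommRing R] (M : ModuleCat.{u} R) : WithBot ℕ∞ :=
  if Subsingleton M then ⊥
  else sInf {d : WithBot ℕ∞ | ∃ (P : ChainComplex (ModuleCat.{u} R) ℤ) (s h : ℤ) (n : ℕ),
    IsQuasiProjectiveResolution M P ∧ IsSup P s ∧ IsHSup P h ∧ s - h = n ∧ d = n}

/-- The embedding dimension of a Noetherian local ring: the dimension of `𝔪 / 𝔪 ^ 2` over the
residue field. -/
def edim (R : Type u) [CommRing R] [IsLocalRing R] : ℕ :=
  Module.finrank (IsLocalRing.ResidueField R) (IsLocalRing.CotangentSpace R)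

/-- The complex `P ⊗_Q R` of `R`-modules, for a ring homomorphism `f : Q →+* R` and a complex `P` of
`Q`-modules. -/
abbrev baseChange {Q R : Type u} [CommRing Q] [CommRing R] (f : Q →+* R)
    (P : ChainComplex (ModuleCat.{u} Q) ℤ) : ChainComplex (ModuleCat.{u} R) ℤ :=
  ((ModuleCat.extendScalars.{u, u, u} f).mapHomologicalComplex (ComplexShape.down ℤ)).obj P

end QuasiProjective

end

/-! Each member `x` of the sequence kills `M`, so multiplication by `x` is null-homotopic on a
projective resolution `P` of `M` over `Q`; it is also regular on the modules of `P`. Hence the long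
exact sequence of `0 → P → P → P/xP → 0` breaks into short ones, which the homotopy splits:
`H_i(P/xP) ≅ H_i(P) ⊕ H_{i-1}(P)` (`linearHomology_mod_regular`). The remaining homotopies descend
to `P/xP`, so killing the members one at a time leaves powers of `M` as homology, with nonzero
exponent in degree 0 (`exists_homology_equiv_pow`). This is (1). For (2), take `P` of length `pd_Q
M`: its base change has `sup ≤ pd_Q M` and `hsup ≥ 0`.

For (3), the maximal ideal of `Q` is generated by a regular sequence. Each syzygy of a finite module
gains one regular element, and a finite module on which the whole sequence is regular is free; so
`pd_Q M` is at most the number of generators of `𝔪_Q`. If the kernel of `Q → R` lies in `𝔪_Q ^ 2`,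
that number is at most `edim R`. Otherwise some member `y` of the sequence lies outside `𝔪_Q ^ 2`,
and `Q` can be replaced by the regular local ring `Q/(y)`, with a shorter sequence. -/

noncomputable section

namespace QuasiProjective

/-! ### Homology modulo a regular null-homotopic element -/

section

section LinearHomology

variable {R : Type*} [CommRing R]

/-- The homology of a pair of composable linear maps. -/
abbrev linearHomology {A B C : Type*} [AddCommGroup A] [AddCommGroup B] [AddCommGroup C]
    [Module R A] [Module R B] [Module R C] (f : A →ₗ[R] B) (g : B →ₗ[R] C) : Type _ :=
  LinearMap.ker g ⧸ (LinearMap.range f).submoduleOf (LinearMap.ker g)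

variable {A₃ A₂ A₁ A₀ B₃ B₂ B₁ : Type*} [AddCommGroup A₃] [AddCommGroup A₂] [AddCommGroup A₁]
  [AddCommGroup A₀] [Module R A₃] [Module R A₂] [Module R A₁] [Module R A₀]
  [AddCommGroup B₃] [AddCommGroup B₂] [AddCommGroup B₁] [Module R B₃] [Module R B₂] [Module R B₁]

/-- If `x` is regular on a complex and multiplication by `x` is null-homotopic, then the homology of
the complex modulo `x` is the sum of the homology of the complex in two adjacent degrees. -/
theorem linearHomology_mod_regular (x : R) (d₃ : A₃ →ₗ[R] A₂) (d₂ : A₂ →ₗ[R] A₁)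
    (d₁ : A₁ →ₗ[R] A₀) (h₂ : A₂ →ₗ[R] A₃) (h₁ : A₁ →ₗ[R] A₂) (h₀ : A₀ →ₗ[R] A₁)
    (δ₃ : B₃ →ₗ[R] B₂) (δ₂ : B₂ →ₗ[R] B₁)
    (q₃ : A₃ →ₗ[R] B₃) (q₂ : A₂ →ₗ[R] B₂) (q₁ : A₁ →ₗ[R] B₁)
    (w₂ : ∀ a, d₂ (d₃ a) = 0) (w₁ : ∀ a, d₁ (d₂ a) = 0)
    (e₂ : ∀ a, d₃ (h₂ a) + h₁ (d₂ a) = x • a) (e₁ : ∀ a, d₂ (h₁ a) + h₀ (d₁ a) = x • a)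
    (r₁ : IsSMulRegular A₁ x) (r₀ : IsSMulRegular A₀ x)
    (c₃ : ∀ a, δ₃ (q₃ a) = q₂ (d₃ a)) (c₂ : ∀ a, δ₂ (q₂ a) = q₁ (d₂ a))
    (s₃ : Function.Surjective q₃) (s₂ : Function.Surjective q₂)
    (k₂ : ∀ a, q₂ a = 0 ↔ ∃ b, x • b = a) (k₁ : ∀ a, q₁ a = 0 ↔ ∃ b, x • b = a) :
    Nonempty (linearHomology δ₃ δ₂ ≃ₗ[R] linearHomology d₃ d₂ × linearHomology d₂ d₁) := by
  -- Since `d₂ (h₁ b) = x • b` for a cycle `b`, `h₁ b` is a cycle modulo `x`; thus `h₁` splits the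
  -- connecting map.
  let φ : LinearMap.ker d₂ × LinearMap.ker d₁ →ₗ[R] LinearMap.ker δ₂ :=
    LinearMap.codRestrict _
      (q₂ ∘ₗ LinearMap.coprod (LinearMap.ker d₂).subtype (h₁ ∘ₗ (LinearMap.ker d₁).subtype)) (by
      rintro ⟨⟨a, ha⟩, ⟨b, hb⟩⟩
      have ha : d₂ a = 0 := ha
      have hb : d₁ b = 0 := hb
      have := e₁ b
      rw [hb, map_zero, add_zero] at this
      simpa [LinearMap.mem_ker, c₂, ha, this] using (k₁ _).2 ⟨b, rfl⟩)
  have hφ : ∀ a b, ((φ (a, b) : LinearMap.ker δ₂) : B₂) = q₂ ((a : A₂) + h₁ b) := fun a b => rfl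
  let Φ := ((LinearMap.range δ₃).submoduleOf (LinearMap.ker δ₂)).mkQ ∘ₗ φ
  let Ψ := LinearMap.prodMap ((LinearMap.range d₃).submoduleOf (LinearMap.ker d₂)).mkQ
    ((LinearMap.range d₂).submoduleOf (LinearMap.ker d₁)).mkQ
  have hΦ : Function.Surjective Φ := by
    refine (Submodule.mkQ_surjective _).comp ?_
    rintro ⟨y, hy⟩
    obtain ⟨y, rfl⟩ := s₂ y
    rw [LinearMap.mem_ker, c₂, k₁] at hy
    obtain ⟨b, hb⟩ := hy
    have hb1 : d₁ b = 0 := r₀ (by simp only [smul_zero]; rw [← map_smul, hb, w₁])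
    have e := e₁ b
    rw [hb1, map_zero, add_zero, hb] at e
    refine ⟨(⟨y - h₁ b, ?_⟩, ⟨b, hb1⟩), ?_⟩
    · rw [LinearMap.mem_ker, map_sub, e, sub_self]
    · apply Subtype.ext
      rw [hφ]
      simp
  have hΨ : Function.Surjective Ψ :=
    Function.Surjective.prodMap (Submodule.mkQ_surjective _) (Submodule.mkQ_surjective _)
  have hker : LinearMap.ker Φ = LinearMap.ker Ψ := by
    ext ⟨⟨a, ha⟩, ⟨b, hb⟩⟩
    have ha' : d₂ a = 0 := ha
    have hb' : d₁ b = 0 := hb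
    have hL : (⟨⟨a, ha⟩, ⟨b, hb⟩⟩ : LinearMap.ker d₂ × LinearMap.ker d₁) ∈ LinearMap.ker Φ ↔
        ∃ w, δ₃ w = q₂ (a + h₁ b) :=
      Submodule.Quotient.mk_eq_zero _
    have hR : (⟨⟨a, ha⟩, ⟨b, hb⟩⟩ : LinearMap.ker d₂ × LinearMap.ker d₁) ∈ LinearMap.ker Ψ ↔
        (∃ w, d₃ w = a) ∧ ∃ v, d₂ v = b :=
      Prod.mk_eq_zero.trans
        (and_congr (Submodule.Quotient.mk_eq_zero _) (Submodule.Quotient.mk_eq_zero _))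
    rw [hL, hR]
    have e := e₁ b
    rw [hb', map_zero, add_zero] at e
    constructor
    · rintro ⟨w, hw⟩
      obtain ⟨w, rfl⟩ := s₃ w
      rw [c₃, ← sub_eq_zero, ← map_sub, k₂] at hw
      obtain ⟨v, hv⟩ := hw
      -- Apply `d₂` to `x • v = d₃ w - (a + h₁ b)` and cancel `x`. Comparing the same equation with
      -- the homotopy relation at `v` then gives `a = d₃ (w - h₂ v)`.
      have hv' : d₂ (-v) = b := by
        apply r₁
        have := congrArg d₂ hv
        simp only [map_smul, map_sub, map_add, w₂, ha', e, zero_add, zero_sub] at this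
        simp [this]
      refine ⟨?_, -v, hv'⟩
      have e' := e₂ v
      have hvb : d₂ v = -b := by rw [← hv', map_neg, neg_neg]
      rw [hvb, map_neg, hv] at e'
      refine ⟨w - h₂ v, ?_⟩
      rw [map_sub, sub_eq_iff_eq_add, ← sub_eq_iff_eq_add']
      have : d₃ (h₂ v) = d₃ w - (a + h₁ b) + h₁ b := by rw [← e']; abel
      rw [this]; abel
    · rintro ⟨⟨w, rfl⟩, ⟨v, rfl⟩⟩
      refine ⟨q₃ (w - h₂ v), ?_⟩
      rw [c₃, ← sub_eq_zero, ← map_sub, k₂]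
      refine ⟨-v, ?_⟩
      rw [smul_neg, ← e₂ v, map_sub]
      abel
  exact ⟨(Φ.quotKerEquivOfSurjective hΦ).symm ≪≫ₗ Submodule.quotEquivOfEq _ _ hker ≪≫ₗ
    Ψ.quotKerEquivOfSurjective hΨ⟩

end LinearHomology

variable {R : Type u} [CommRing R]

/-- The homology of a complex of modules, in terms of cycles and boundaries. -/
def homologyEquiv (P : ChainComplex (ModuleCat.{u} R) ℤ) (i j k : ℤ) (hij : j + 1 = i)
    (hjk : k + 1 = j) :
    P.homology j ≃ₗ[R] linearHomology (P.d i j).hom (P.d j k).hom :=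
  ((P.homologyIsoSc' i j k (by simp [hij]) (by subst hjk; simp)) ≪≫
    (P.sc' i j k).moduleCatHomologyIso).toLinearEquiv ≪≫ₗ
    Submodule.quotEquivOfEq _ _ (by
      ext y
      constructor
      · rintro ⟨z, rfl⟩
        exact ⟨z, rfl⟩
      · rintro ⟨z, hz⟩
        exact ⟨z, Subtype.ext hz⟩)

end

/-! ### Null-homotopies on resolutions and quotients by a sequence -/

section

open Pointwise

variable {R : Type u} [CommRing R]

/-- Multiplication by `x` on the complex `P` is null-homotopic in all degrees up to `n`. -/
def IsNullHomotopicUpTo (x : R) (P : ChainComplex (ModuleCat.{u} R) ℤ) (n : ℤ) : Prop :=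
  ∃ h : ∀ i j : ℤ, P.X i →ₗ[R] P.X j, ∀ i j k : ℤ, j + 1 = i → k + 1 = j → j ≤ n →
    ∀ a : P.X j, P.d i j (h j i a) + h k j (P.d j k a) = x • a

theorem d_d_apply (P : ChainComplex (ModuleCat.{u} R) ℤ) (i j k : ℤ) (a : P.X i) :
    P.d j k (P.d i j a) = 0 := by
  rw [← ModuleCat.comp_apply, P.d_comp_d]
  rfl

/-- An annihilator of a module is null-homotopic on the projective resolutions of the module. -/
theorem IsProjectiveResolution.isNullHomotopicUpTo {M : ModuleCat.{u} R}
    {P : ChainComplex (ModuleCat.{u} R) ℤ} (hP : IsProjectiveResolution M P) {x : R}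
    (hx : ∀ m : M, x • m = 0) (n : ℕ) : IsNullHomotopicUpTo x P (n - 1) := by
  induction n with
  | zero =>
    refine ⟨fun _ _ => 0, fun i j k _ _ hj a => ?_⟩
    have := hP.subsingleton_of_neg j (by push_cast at hj; omega)
    exact Subsingleton.elim _ _
  | succ n ih =>
    obtain ⟨h, hh⟩ := ih
    have hproj := hP.projective n
    let d := (P.d (n + 1) n).hom
    let d' := (P.d n (n - 1)).hom
    -- The new component of the homotopy is a lift of `θ` through `d`, which exists once `θ` takes
    -- values in the boundaries.
    let θ : P.X n →ₗ[R] P.X n := x • LinearMap.id - h (n - 1) n ∘ₗ d'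
    have hθ : ∀ a, θ a = x • a - h (n - 1) n (P.d n (n - 1) a) := fun a => rfl
    have E := homologyEquiv P (n + 1) n (n - 1) rfl (by omega)
    have hmem : ∀ a, θ a ∈ LinearMap.range d := by
      intro a
      suffices ∃ b : LinearMap.ker d', (b : P.X n) = θ a ∧
          (Submodule.Quotient.mk b : linearHomology d d') = 0 by
        obtain ⟨b, hb, hb'⟩ := this
        rw [Submodule.Quotient.mk_eq_zero] at hb'
        rw [← hb]
        exact hb'
      -- In degree 0, `θ` is multiplication by `x`, which is zero on `H_0 ≅ M`. In positive degrees
      -- the homotopy relation one degree lower makes `θ a` a cycle, and cycles are boundaries.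
      obtain rfl | hn := Nat.eq_zero_or_pos n
      · have hsub := hP.subsingleton_of_neg (((0 : ℕ) : ℤ) - 1) (by simp)
        refine ⟨⟨θ a, Subsingleton.elim _ _⟩, rfl, ?_⟩
        obtain ⟨F⟩ := hP.homology_zero
        let G : linearHomology d d' ≃ₗ[R] M := E.symm ≪≫ₗ F
        have : (⟨θ a, Subsingleton.elim _ _⟩ : LinearMap.ker d') =
            x • ⟨a, Subsingleton.elim _ _⟩ := by
          apply Subtype.ext
          change θ a = x • a
          rw [hθ, Subsingleton.elim (P.d _ (((0 : ℕ) : ℤ) - 1) a) 0, map_zero, sub_zero]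
        rw [this, Submodule.Quotient.mk_smul]
        apply G.injective
        rw [map_smul, hx, map_zero]
      · have hsub := hP.exact_of_pos n (by omega)
        have := E.symm.injective.subsingleton
        refine ⟨⟨θ a, ?_⟩, rfl, Subsingleton.elim _ _⟩
        change P.d n (n - 1) (θ a) = 0
        have := hh n (n - 1) (n - 2) (by omega) (by omega) le_rfl (P.d n (n - 1) a)
        rw [d_d_apply, map_zero, add_zero] at this
        rw [hθ, map_sub, map_smul, this, sub_self]
    obtain ⟨g, hg⟩ := Module.projective_lifting_property d.rangeRestrict
      (θ.codRestrict _ hmem) d.surjective_rangeRestrict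
    have hg' : ∀ a, P.d (n + 1) n (g a) = θ a := fun a =>
      congrArg Subtype.val (LinearMap.congr_fun hg a)
    refine ⟨Function.update h n (Function.update (h n) (n + 1) g), ?_⟩
    intro i j k hij hjk hj a
    push_cast at hj
    rw [Function.update_of_ne (a := k) (by omega)]
    obtain hj | rfl := lt_or_eq_of_le (show j ≤ n by omega)
    · rw [Function.update_of_ne (by omega)]
      exact hh i j k hij hjk (by omega) a
    · obtain rfl := hij
      obtain rfl : k = n - 1 := by omega
      rw [Function.update_self, Function.update_self, hg', hθ, sub_add_cancel]

/-- The complex `P / x P`. -/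
def quotSMulTopComplex (x : R) (P : ChainComplex (ModuleCat.{u} R) ℤ) :
    ChainComplex (ModuleCat.{u} R) ℤ where
  X i := ModuleCat.of R (QuotSMulTop x (P.X i))
  d i j := ModuleCat.ofHom (QuotSMulTop.map x (P.d i j).hom)
  shape i j hij := by rw [P.shape i j hij]; ext; simp
  d_comp_d' i j k _ _ := by
    rw [← ModuleCat.ofHom_comp, ← QuotSMulTop.map_comp, ← ModuleCat.hom_comp, P.d_comp_d]
    ext; simp

theorem quotSMulTop_mk_eq_zero_iff {A : Type*} [AddCommGroup A] [Module R A] (x : R) (a : A) :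
    (Submodule.Quotient.mk a : QuotSMulTop x A) = 0 ↔ ∃ b, x • b = a := by
  rw [Submodule.Quotient.mk_eq_zero, Submodule.mem_smul_pointwise_iff_exists]
  simp

theorem IsNullHomotopicUpTo.quotSMulTopComplex {x y : R} {P : ChainComplex (ModuleCat.{u} R) ℤ}
    {n : ℤ} (h : IsNullHomotopicUpTo y P n) :
    IsNullHomotopicUpTo y (quotSMulTopComplex x P) n := by
  obtain ⟨h, hh⟩ := h
  refine ⟨fun i j => QuotSMulTop.map x (h i j), fun i j k hij hjk hj a => ?_⟩
  obtain ⟨a, rfl⟩ := Submodule.Quotient.mk_surjective _ a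
  exact congrArg Submodule.Quotient.mk (hh i j k hij hjk hj a)

/-- Only the homotopy relations in degrees `i` and `i - 1` enter, so homotopies up to each finite
degree suffice and need not be compatible. -/
theorem homology_quotSMulTopComplex {x : R} {P : ChainComplex (ModuleCat.{u} R) ℤ}
    (reg : ∀ i, IsSMulRegular (P.X i) x) (h : ∀ n : ℕ, IsNullHomotopicUpTo x P n) (i : ℤ) :
    Nonempty ((quotSMulTopComplex x P).homology i ≃ₗ[R] P.homology i × P.homology (i - 1)) := by
  obtain ⟨h, hh⟩ := h i.toNat
  have hle : i ≤ i.toNat := Int.self_le_toNat i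
  obtain ⟨e⟩ := linearHomology_mod_regular x (P.d (i + 1) i).hom (P.d i (i - 1)).hom
    (P.d (i - 1) (i - 2)).hom (h i (i + 1)) (h (i - 1) i) (h (i - 2) (i - 1))
    ((quotSMulTopComplex x P).d (i + 1) i).hom ((quotSMulTopComplex x P).d i (i - 1)).hom
    (Submodule.mkQ _) (Submodule.mkQ _) (Submodule.mkQ _)
    (d_d_apply P _ _ _) (d_d_apply P _ _ _)
    (hh (i + 1) i (i - 1) rfl (by omega) (by omega))
    (hh i (i - 1) (i - 2) (by omega) (by omega) (by omega)) (reg _) (reg _)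
    (fun _ => rfl) (fun _ => rfl) (Submodule.mkQ_surjective _) (Submodule.mkQ_surjective _)
    (quotSMulTop_mk_eq_zero_iff x) (quotSMulTop_mk_eq_zero_iff x)
  exact ⟨homologyEquiv _ (i + 1) i (i - 1) rfl (by omega) ≪≫ₗ e ≪≫ₗ
    (homologyEquiv _ (i + 1) i (i - 1) rfl (by omega)).symm.prodCongr
    (homologyEquiv _ i (i - 1) (i - 2) (by omega) (by omega)).symm⟩

open RingTheory.Sequence in
/-- Let `C` be the quotient of the complex `P` by a sequence that is weakly regular on `P` and whose
members are null-homotopic on `P`. If the homology modules of `P` are powers of `M`, so are those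
of `C`. -/
theorem exists_homology_equiv_pow (M : Type u) [AddCommGroup M] [Module R M] (xs : List R)
    (P C : ChainComplex (ModuleCat.{u} R) ℤ) (π : P ⟶ C)
    (hπ : ∀ i, Function.Surjective (π.f i))
    (hker : ∀ i, LinearMap.ker (π.f i).hom = Ideal.ofList xs • ⊤)
    (reg : ∀ i, IsWeaklyRegular (P.X i) xs)
    (h : ∀ x ∈ xs, ∀ n : ℕ, IsNullHomotopicUpTo x P n) (a : ℤ → ℕ) (ha : a 0 ≠ 0)
    (e : ∀ i, Nonempty (P.homology i ≃ₗ[R] (Fin (a i) → M))) :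
    ∃ a' : ℤ → ℕ, a' 0 ≠ 0 ∧ ∀ i, Nonempty (C.homology i ≃ₗ[R] (Fin (a' i) → M)) := by
  induction xs generalizing P a with
  | nil =>
    refine ⟨a, ha, fun i => ?_⟩
    have : ∀ i, IsIso (π.f i) := fun i => by
      rw [ConcreteCategory.isIso_iff_bijective]
      refine ⟨?_, hπ i⟩
      have := hker i
      rw [Ideal.ofList_nil, Submodule.bot_smul, LinearMap.ker_eq_bot] at this
      exact this
    have : IsIso π := HomologicalComplex.Hom.isIso_of_components π
    obtain ⟨e⟩ := e i
    exact ⟨((HomologicalComplex.homologyFunctor _ _ i).mapIso (asIso π)).toLinearEquiv.symm ≪≫ₗ e⟩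
  | cons x xs ih =>
    have hker' : ∀ i, x • (⊤ : Submodule R (P.X i)) ≤ LinearMap.ker (π.f i).hom := fun i => by
      rw [hker, Ideal.ofList_cons, Submodule.sup_smul, Submodule.ideal_span_singleton_smul]
      exact le_sup_left
    let π' : quotSMulTopComplex x P ⟶ C :=
      { f := fun i => ModuleCat.ofHom ((x • (⊤ : Submodule R (P.X i))).liftQ _ (hker' i))
        comm' := fun i j _ => by
          ext a
          obtain ⟨a, rfl⟩ := Submodule.Quotient.mk_surjective _ a
          exact congrArg (fun f => f.hom a) (π.comm i j) }
    have hπ' : ∀ i (a : P.X i), π'.f i (Submodule.Quotient.mk a) = π.f i a := fun i a => rfl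
    -- The exponents add up as `a i + a (i - 1)`, so the one in degree 0 stays nonzero.
    refine ih (quotSMulTopComplex x P) π' ?_ ?_ ?_ ?_ (fun i => a i + a (i - 1)) (by simp [ha]) ?_
    · intro i c
      obtain ⟨a, rfl⟩ := hπ i c
      exact ⟨Submodule.Quotient.mk a, rfl⟩
    · intro i
      -- Both submodules of `P_i / x P_i` are compared through their preimages in `P_i`.
      apply Submodule.comap_injective_of_surjective
        (Submodule.mkQ_surjective (x • (⊤ : Submodule R (P.X i))))
      have h₁ : (LinearMap.ker (π'.f i).hom).comap (x • (⊤ : Submodule R (P.X i))).mkQ =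
          LinearMap.ker (π.f i).hom := rfl
      have h₂ : Ideal.ofList xs • (⊤ : Submodule R (QuotSMulTop x (P.X i))) =
          (Ideal.ofList xs • (⊤ : Submodule R (P.X i))).map
            (x • (⊤ : Submodule R (P.X i))).mkQ := by
        rw [Submodule.map_smul'', Submodule.map_top, Submodule.range_mkQ]
      rw [h₁, hker]
      refine Eq.trans ?_ (congrArg _ h₂.symm)
      rw [Submodule.comap_map_mkQ, Ideal.ofList_cons, Submodule.sup_smul,
        Submodule.ideal_span_singleton_smul]
    · intro i
      exact ((isWeaklyRegular_cons_iff _ _ _).1 (reg i)).2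
    · intro y hy n
      exact (h y (List.mem_cons_of_mem _ hy) n).quotSMulTopComplex
    · intro i
      obtain ⟨f⟩ := homology_quotSMulTopComplex
        (fun i => ((isWeaklyRegular_cons_iff _ _ _).1 (reg i)).1) (h x List.mem_cons_self) i
      obtain ⟨e₁⟩ := e i
      obtain ⟨e₂⟩ := e (i - 1)
      exact ⟨f ≪≫ₗ e₁.prodCongr e₂ ≪≫ₗ (LinearEquiv.sumArrowLequivProdArrow _ _ R M).symm ≪≫ₗ
        LinearEquiv.funCongrLeft R M finSumFinEquiv.symm⟩

end

/-! ### Base change along a surjection -/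

section

open TensorProduct in
theorem ker_tensorProductMk_of_surjective {Q R N : Type*} [CommRing Q] [CommRing R] [Algebra Q R]
    [AddCommGroup N] [Module Q N] (h : Function.Surjective (algebraMap Q R)) :
    LinearMap.ker (TensorProduct.mk Q R N 1) = RingHom.ker (algebraMap Q R) • ⊤ := by
  let e : (Q ⧸ RingHom.ker (algebraMap Q R)) ≃ₗ[Q] R :=
    (Ideal.quotientKerAlgEquivOfSurjective (f := Algebra.ofId Q R) h).toLinearEquiv
  have he : TensorProduct.mk Q R N 1 = (TensorProduct.congr e (LinearEquiv.refl Q N)).toLinearMap ∘ₗ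
      TensorProduct.mk Q (Q ⧸ RingHom.ker (algebraMap Q R)) N 1 := by
    ext n
    have : e 1 = 1 := map_one (Ideal.quotientKerAlgEquivOfSurjective (f := Algebra.ofId Q R) h)
    simp [this]
  rw [he, LinearEquiv.ker_comp, LinearMap.ker_tensorProductMk]

variable {Q R : Type u} [CommRing Q] [CommRing R]

/-- The canonical map from a complex to its base change. -/
def toBaseChange (f : Q →+* R) (P : ChainComplex (ModuleCat.{u} Q) ℤ) :
    P ⟶ ((ModuleCat.restrictScalars f).mapHomologicalComplex (ComplexShape.down ℤ)).obj
      (baseChange f P) where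
  f i := (ModuleCat.extendRestrictScalarsAdj f).unit.app (P.X i)
  comm' i j _ := ((ModuleCat.extendRestrictScalarsAdj f).unit.naturality (P.d i j)).symm

theorem toBaseChange_surjective {f : Q →+* R} (hf : Function.Surjective f)
    (P : ChainComplex (ModuleCat.{u} Q) ℤ) (i : ℤ) :
    Function.Surjective ((toBaseChange f P).f i) := by
  algebraize [f]
  exact TensorProduct.mk_surjective Q (P.X i) R hf

theorem ker_toBaseChange {f : Q →+* R} (hf : Function.Surjective f)
    (P : ChainComplex (ModuleCat.{u} Q) ℤ) (i : ℤ) :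
    LinearMap.ker ((toBaseChange f P).f i).hom = RingHom.ker f • ⊤ := by
  algebraize [f]
  exact ker_tensorProductMk_of_surjective (Q := Q) (R := R) (N := P.X i) hf

theorem projective_baseChange_X (f : Q →+* R) {P : ChainComplex (ModuleCat.{u} Q) ℤ} {i : ℤ}
    (h : Module.Projective Q (P.X i)) : Module.Projective R ((baseChange f P).X i) := by
  algebraize [f]
  exact inferInstanceAs (Module.Projective R (TensorProduct Q R (P.X i)))

theorem subsingleton_baseChange_X (f : Q →+* R) {P : ChainComplex (ModuleCat.{u} Q) ℤ} {i : ℤ}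
    (h : Subsingleton (P.X i)) : Subsingleton ((baseChange f P).X i) := by
  algebraize [f]
  exact inferInstanceAs (Subsingleton (TensorProduct Q R (P.X i)))

/-- A linear equivalence after restriction of scalars along a surjection is linear. -/
theorem nonempty_linearEquiv_of_restrictScalars {f : Q →+* R} (hf : Function.Surjective f)
    {N M : ModuleCat.{u} R} {n : ℕ}
    (e : (ModuleCat.restrictScalars f).obj N ≃ₗ[Q]
      (Fin n → (ModuleCat.restrictScalars f).obj M)) :
    Nonempty (N ≃ₗ[R] (Fin n → M)) :=
  ⟨{ toFun := fun a => e a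
     invFun := fun a => e.symm a
     left_inv := e.left_inv
     right_inv := e.right_inv
     map_add' := e.map_add
     map_smul' := fun r a => by
       obtain ⟨q, rfl⟩ := hf r
       exact e.map_smul q a }⟩

/-- Restriction of scalars commutes with homology. -/
def restrictScalarsHomologyIso (f : Q →+* R) (C : ChainComplex (ModuleCat.{u} R) ℤ) (i : ℤ) :
    (((ModuleCat.restrictScalars f).mapHomologicalComplex (ComplexShape.down ℤ)).obj C).homology i ≅
      (ModuleCat.restrictScalars f).obj (C.homology i) :=
  (C.sc i).mapHomologyIso (ModuleCat.restrictScalars f)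

theorem smul_eq_zero_of_mem_ker {f : Q →+* R} (M : ModuleCat.{u} R) {x : Q}
    (hx : x ∈ RingHom.ker f) (m : (ModuleCat.restrictScalars f).obj M) : x • m = 0 := by
  change (HSMul.hSMul (f x) m : M) = 0
  rw [RingHom.mem_ker.1 hx]
  exact zero_smul R (show M from m)

open RingTheory.Sequence in
-- Projective modules are flat, so `x` is weakly regular on each `P_i`, and the induction starts
-- from exponent 1 in degree 0 and 0 elsewhere. The isomorphisms found over `Q` are `R`-linear
-- because `f` is surjective. The nonzero exponent in degree 0 is what later bounds `hsup` from
-- below.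
theorem IsProjectiveResolution.exists_homology_baseChange {x : List Q} (hx : IsWeaklyRegular Q x)
    {f : Q →+* R} (hf : Function.Surjective f) (hker : RingHom.ker f = Ideal.ofList x)
    {M : ModuleCat.{u} R} {P : ChainComplex (ModuleCat.{u} Q) ℤ}
    (hP : IsProjectiveResolution ((ModuleCat.restrictScalars f).obj M) P) :
    ∃ a : ℤ → ℕ, a 0 ≠ 0 ∧
      ∀ i, Nonempty ((baseChange f P).homology i ≃ₗ[R] (Fin (a i) → M)) := by
  obtain ⟨a, ha, e⟩ := exists_homology_equiv_pow ((ModuleCat.restrictScalars f).obj M) x P _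
    (toBaseChange f P) (toBaseChange_surjective hf P)
    (fun i => by rw [ker_toBaseChange hf, hker])
    (fun i => by
      have := hP.projective i
      exact ((TensorProduct.lid Q (P.X i)).isWeaklyRegular_congr x).1
        hx.isWeaklyRegular_rTensor)
    (fun y hy n => by
      -- The bound produced is one below the argument, hence `n + 1`.
      obtain ⟨h, hh⟩ := hP.isNullHomotopicUpTo (x := y)
        (fun m => smul_eq_zero_of_mem_ker M (by rw [hker]; exact Ideal.subset_span hy) m) (n + 1)
      exact ⟨h, by simpa using hh⟩)
    (fun i => if i = 0 then 1 else 0) (by simp)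
    (fun i => by
      rcases lt_trichotomy i 0 with hi | rfl | hi
      · rw [if_neg hi.ne]
        have := hP.subsingleton_of_neg i hi
        have := (homologyEquiv P (i + 1) i (i - 1) rfl (by omega)).injective.subsingleton
        exact ⟨0, 0, fun _ => Subsingleton.elim _ _, fun _ => Subsingleton.elim _ _⟩
      · obtain ⟨e⟩ := hP.homology_zero
        exact ⟨e ≪≫ₗ (LinearEquiv.funUnique (Fin 1) Q _).symm⟩
      · rw [if_neg hi.ne']
        have := hP.exact_of_pos i hi
        exact ⟨0, 0, fun _ => Subsingleton.elim _ _, fun _ => Subsingleton.elim _ _⟩)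
  refine ⟨a, ha, fun i => ?_⟩
  obtain ⟨e⟩ := e i
  exact nonempty_linearEquiv_of_restrictScalars hf
    ((restrictScalarsHomologyIso f _ i).toLinearEquiv.symm ≪≫ₗ e)

open RingTheory.Sequence in
theorem IsProjectiveResolution.isQuasiProjectiveResolution_baseChange {x : List Q}
    (hx : IsWeaklyRegular Q x)
    {f : Q →+* R} (hf : Function.Surjective f) (hker : RingHom.ker f = Ideal.ofList x)
    {M : ModuleCat.{u} R} {P : ChainComplex (ModuleCat.{u} Q) ℤ}
    (hP : IsProjectiveResolution ((ModuleCat.restrictScalars f).obj M) P) :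
    IsQuasiProjectiveResolution M (baseChange f P) where
  projective i := projective_baseChange_X f (hP.projective i)
  boundedBelow := ⟨0, fun i hi => subsingleton_baseChange_X f (hP.subsingleton_of_neg i hi)⟩
  homology_eq := by
    obtain ⟨a, ha, e⟩ := hP.exists_homology_baseChange hx hf hker
    exact ⟨a, ⟨0, ha⟩, e⟩

end

/-! ### A resolution of minimal length and the bound by projective dimension -/

section

variable {R : Type u} [CommRing R]

/-- Covering a projective module by itself makes the resolution stop as soon as a syzygy is
projective, so no truncation is needed. -/
theorem exists_cover (M : ModuleCat.{u} R) :
    ∃ (N : ModuleCat.{u} R) (φ : N →ₗ[R] M), Module.Projective R N ∧ Function.Surjective φ ∧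
      (Module.Projective R M → Function.Injective φ) := by
  by_cases h : Module.Projective R M
  · exact ⟨M, LinearMap.id, h, Function.surjective_id, fun _ => Function.injective_id⟩
  · exact ⟨ModuleCat.of R (M →₀ R), Finsupp.linearCombination R id,
      inferInstanceAs (Module.Projective R (M →₀ R)),
      Finsupp.linearCombination_id_surjective R M, fun h' => absurd h' h⟩

/-- A projective module mapping onto `M`, isomorphic to `M` if `M` is projective. -/
def coverModule (M : ModuleCat.{u} R) : ModuleCat.{u} R := (exists_cover M).choose

/-- The surjection from `coverModule M` onto `M`. -/
def coverMap (M : ModuleCat.{u} R) : coverModule M →ₗ[R] M := (exists_cover M).choose_spec.choose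

instance (M : ModuleCat.{u} R) : Module.Projective R (coverModule M) :=
  (exists_cover M).choose_spec.choose_spec.1

theorem coverMap_surjective (M : ModuleCat.{u} R) : Function.Surjective (coverMap M) :=
  (exists_cover M).choose_spec.choose_spec.2.1

theorem coverMap_injective (M : ModuleCat.{u} R) [h : Module.Projective R M] :
    Function.Injective (coverMap M) :=
  (exists_cover M).choose_spec.choose_spec.2.2 h

/-- The syzygies of `M` with respect to the covers `coverModule`. -/
def syzygy (M : ModuleCat.{u} R) : ℕ → ModuleCat.{u} R
  | 0 => M
  | n + 1 => ModuleCat.of R (LinearMap.ker (coverMap (syzygy M n)))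

theorem subsingleton_syzygy_succ (M : ModuleCat.{u} R) (n : ℕ)
    [h : Module.Projective R (syzygy M n)] : Subsingleton (syzygy M (n + 1)) := by
  change Subsingleton (LinearMap.ker (coverMap (syzygy M n)))
  rw [LinearMap.ker_eq_bot.2 (coverMap_injective _)]
  infer_instance

theorem subsingleton_coverModule (M : ModuleCat.{u} R) [h : Subsingleton M] :
    Subsingleton (coverModule M) :=
  (coverMap_injective M).subsingleton

theorem subsingleton_coverModule_syzygy (M : ModuleCat.{u} R) {n m : ℕ}
    (h : Module.Projective R (syzygy M n)) (hm : n < m) :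
    Subsingleton (coverModule (syzygy M m)) := by
  suffices Subsingleton (syzygy M m) from subsingleton_coverModule _
  induction m, hm using Nat.le_induction with
  | base => exact subsingleton_syzygy_succ M n
  | succ m _ ih =>
    have : Module.Projective R (syzygy M m) := inferInstance
    exact subsingleton_syzygy_succ M m

/-- Dimension shifting: each syzygy lowers the bound on the projective dimension by one. -/
theorem projective_syzygy (M : ModuleCat.{u} R) {n : ℕ} (h : HasProjectiveDimensionLE M n) :
    Module.Projective R (syzygy M n) := by
  suffices ∀ k m, m + k = n → HasProjectiveDimensionLT (syzygy M m) (k + 1) by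
    rw [IsProjective.iff_projective, projective_iff_hasProjectiveDimensionLT_one]
    exact this 0 n rfl
  intro k m hk
  induction m generalizing k with
  | zero =>
    obtain rfl : k = n := by omega
    exact h
  | succ m ih =>
    have hS := LinearMap.shortExact_shortComplexKer (coverMap_surjective (syzygy M m))
    have hp : Projective (coverModule (syzygy M m)) :=
      (IsProjective.iff_projective _).1
        (inferInstanceAs (Module.Projective R (coverModule (syzygy M m))))
    have h1 : HasProjectiveDimensionLT (coverModule (syzygy M m)) 1 := inferInstance
    exact hS.hasProjectiveDimensionLT_X₁ (k + 1)
      (hasProjectiveDimensionLT_of_ge _ 1 (k + 1) (by omega)) (ih (k + 1) (by omega))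

/-- The modules of the resolution of `M` by the covers of its syzygies. -/
def resolutionX (M : ModuleCat.{u} R) : ℤ → ModuleCat.{u} R
  | .ofNat n => coverModule (syzygy M n)
  | .negSucc _ => ModuleCat.of R PUnit

/-- The differentials of the resolution of `M` by the covers of its syzygies. -/
def resolutionD (M : ModuleCat.{u} R) : ∀ i : ℤ, resolutionX M (i + 1) ⟶ resolutionX M i
  | .ofNat n => ModuleCat.ofHom
      ((LinearMap.ker (coverMap (syzygy M n))).subtype ∘ₗ coverMap (syzygy M (n + 1)))
  | .negSucc _ => 0

theorem range_resolutionD (M : ModuleCat.{u} R) (n : ℕ) :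
    LinearMap.range (resolutionD M n).hom = LinearMap.ker (coverMap (syzygy M n)) := by
  ext a
  constructor
  · rintro ⟨b, rfl⟩
    exact (show LinearMap.ker (coverMap (syzygy M n)) from coverMap (syzygy M (n + 1)) b).2
  · intro ha
    obtain ⟨b, hb⟩ := coverMap_surjective (syzygy M (n + 1)) ⟨a, ha⟩
    exact ⟨b, congrArg (Subtype.val (p := (· ∈ LinearMap.ker (coverMap (syzygy M n))))) hb⟩

theorem ker_resolutionD (M : ModuleCat.{u} R) (n : ℕ) :
    LinearMap.ker (resolutionD M n).hom = LinearMap.ker (coverMap (syzygy M (n + 1))) := by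
  ext a
  exact (Subtype.ext_iff (a1 := (show LinearMap.ker (coverMap (syzygy M n)) from
    coverMap (syzygy M (n + 1)) a)) (a2 := 0)).symm

theorem resolutionD_comp (M : ModuleCat.{u} R) (n : ℤ) :
    resolutionD M (n + 1) ≫ resolutionD M n = 0 := by
  obtain n | n := n
  · ext a
    have h : (resolutionD M (Int.ofNat (n + 1))).hom a ∈
        LinearMap.ker (resolutionD M (Int.ofNat n)).hom :=
      (ker_resolutionD M n).ge ((range_resolutionD M (n + 1)).le ⟨a, rfl⟩)
    exact h
  · exact Limits.comp_zero

/-- The resolution of `M` by the covers of its syzygies. -/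
def resolution (M : ModuleCat.{u} R) : ChainComplex (ModuleCat.{u} R) ℤ :=
  ChainComplex.of (resolutionX M) (resolutionD M) (resolutionD_comp M)

theorem isProjectiveResolution_resolution (M : ModuleCat.{u} R) :
    IsProjectiveResolution M (resolution M) where
  projective
    | .ofNat n => inferInstanceAs (Module.Projective R (coverModule (syzygy M n)))
    | .negSucc _ => inferInstanceAs (Module.Projective R PUnit.{u + 1})
  subsingleton_of_neg
    | .ofNat n, hn => absurd hn (by simp)
    | .negSucc _, _ => inferInstanceAs (Subsingleton PUnit.{u + 1})
  exact_of_pos i hi := by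
    obtain ⟨n, rfl⟩ : ∃ n : ℕ, i = n + 1 := ⟨(i - 1).toNat, by omega⟩
    suffices Subsingleton (linearHomology ((resolution M).d (n + 1 + 1) (n + 1)).hom
        ((resolution M).d (n + 1) n).hom) from
      (homologyEquiv (resolution M) (n + 1 + 1) (n + 1) n rfl rfl).injective.subsingleton
    rw [Submodule.Quotient.subsingleton_iff, eq_top_iff]
    rintro ⟨a, ha⟩ -
    have h₁ : (resolution M).d (n + 1) n = resolutionD M n := ChainComplex.of_d _ _ _
    have h₂ : (resolution M).d (n + 1 + 1) (n + 1) = resolutionD M (n + 1) :=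
      ChainComplex.of_d _ _ _
    rw [h₁] at ha
    change a ∈ LinearMap.range _
    rw [h₂]
    exact (range_resolutionD M (n + 1)).ge ((ker_resolutionD M n).le ha)
  homology_zero := by
    have h₁ : (resolution M).d (0 + 1) 0 = resolutionD M 0 :=
      ChainComplex.of_d (resolutionX M) (resolutionD M) 0
    have htop : LinearMap.ker ((resolution M).d 0 (-1)).hom = ⊤ :=
      eq_top_iff.2 fun a _ => (rfl : (_ : PUnit.{u + 1}) = _)
    let φ : LinearMap.ker ((resolution M).d 0 (-1)).hom →ₗ[R] M :=
      coverMap M ∘ₗ (LinearMap.ker ((resolution M).d 0 (-1)).hom).subtype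
    have hφ : Function.Surjective φ := fun m => by
      obtain ⟨a, rfl⟩ := coverMap_surjective M m
      exact ⟨⟨a, htop.ge trivial⟩, rfl⟩
    refine ⟨homologyEquiv (resolution M) (0 + 1) 0 (-1) rfl rfl ≪≫ₗ
      Submodule.quotEquivOfEq _ _ ?_ ≪≫ₗ φ.quotKerEquivOfSurjective hφ⟩
    rw [h₁]
    exact congrArg (Submodule.comap _) (range_resolutionD M 0)

theorem subsingleton_resolution_X {M : ModuleCat.{u} R} {n : ℕ} (h : HasProjectiveDimensionLE M n)
    {i : ℤ} (hi : n < i) : Subsingleton ((resolution M).X i) := by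
  obtain ⟨m, rfl⟩ := Int.eq_ofNat_of_zero_le (show 0 ≤ i by omega)
  exact subsingleton_coverModule_syzygy M (projective_syzygy M h) (by omega)

theorem subsingleton_homology {P : ChainComplex (ModuleCat.{u} R) ℤ} {i : ℤ}
    (h : Subsingleton (P.X i)) : Subsingleton (P.homology i) :=
  (homologyEquiv P (i + 1) i (i - 1) rfl (by omega)).injective.subsingleton

variable {Q : Type u} [CommRing Q]

open RingTheory.Sequence in
-- The base change of a resolution of length `n = pd_Q M` lives in degrees at most `n` and has
-- nonzero `H_0`, so `sup - hsup ≤ n`.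
theorem qpd_le_projectiveDimension {x : List Q} (hx : IsWeaklyRegular Q x)
    {f : Q →+* R} (hf : Function.Surjective f) (hker : RingHom.ker f = Ideal.ofList x)
    (M : ModuleCat.{u} R) :
    qpd M ≤ projectiveDimension ((ModuleCat.restrictScalars f).obj M) := by
  unfold qpd
  split_ifs with hM
  · exact bot_le
  rw [not_subsingleton_iff_nontrivial] at hM
  set N := (ModuleCat.restrictScalars f).obj M
  by_cases htop : projectiveDimension N = ⊤
  · rw [htop]; exact le_top
  have hbot : projectiveDimension N ≠ ⊥ := by
    rw [Ne, projectiveDimension_eq_bot_iff, ModuleCat.isZero_iff_subsingleton]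
    exact not_subsingleton_iff_nontrivial.2 hM
  obtain ⟨n, hn⟩ : ∃ n : ℕ, projectiveDimension N = n := by
    generalize projectiveDimension N = d at htop hbot
    cases d with
    | bot => exact absurd rfl hbot
    | coe d =>
      cases d with
      | top => exact absurd rfl htop
      | coe n => exact ⟨n, rfl⟩
  have hpd : HasProjectiveDimensionLE N n := (projectiveDimension_le_iff N n).1 hn.le
  have hP := isProjectiveResolution_resolution N
  set P := baseChange f (resolution N) with hPdef
  have hzero : ∀ i : ℤ, n < i → Subsingleton (P.X i) := fun i hi =>
    subsingleton_baseChange_X f (subsingleton_resolution_X hpd hi)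
  have hX : ∀ i : ℤ, Nontrivial (P.X i) → i ≤ n := fun i hi => by
    by_contra! h
    exact not_subsingleton_iff_nontrivial.2 hi (hzero i h)
  have hH : ∀ i : ℤ, Nontrivial (P.homology i) → Nontrivial (P.X i) := fun i hi => by
    by_contra! h
    exact not_subsingleton_iff_nontrivial.2 hi (subsingleton_homology h)
  obtain ⟨a, ha, e⟩ := hP.exists_homology_baseChange hx hf hker
  have hH0 : Nontrivial (P.homology 0) := by
    obtain ⟨e⟩ := e 0
    have : Nonempty (Fin (a 0)) := ⟨⟨0, Nat.pos_of_ne_zero ha⟩⟩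
    exact e.toEquiv.nontrivial
  have exists_greatest : ∀ p : ℤ → Prop, (∀ i, p i → i ≤ n) → p 0 →
      ∃ s, IsGreatest {i | p i} s := fun p hp hp0 => by
    obtain ⟨s, hs, hs'⟩ := Int.exists_greatest_of_bdd ⟨n, hp⟩ ⟨0, hp0⟩
    exact ⟨s, hs, hs'⟩
  obtain ⟨s, hs⟩ : ∃ s, IsSup P s := exists_greatest _ hX (hH 0 hH0)
  obtain ⟨h, hh⟩ : ∃ h, IsHSup P h := exists_greatest _ (fun i hi => hX i (hH i hi)) hH0
  have h0 : 0 ≤ h := hh.2 hH0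
  have hhs : h ≤ s := hs.2 (hH h hh.1)
  have hsn : s ≤ n := hX s hs.1
  rw [hn]
  have hmem : (((s - h).toNat : ℕ) : WithBot ℕ∞) ∈ {d : WithBot ℕ∞ |
      ∃ (P : ChainComplex (ModuleCat.{u} R) ℤ) (s h : ℤ) (n : ℕ),
        IsQuasiProjectiveResolution M P ∧ IsSup P s ∧ IsHSup P h ∧ s - h = n ∧ d = n} := ⟨P, s, h, (s - h).toNat,
    hP.isQuasiProjectiveResolution_baseChange hx hf hker, hs, hh, by omega, rfl⟩
  refine (sInf_le hmem).trans ?_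
  exact_mod_cast (by omega : (s - h).toNat ≤ n)

end

/-! ### Regular local rings: domains whose maximal ideal is generated by a regular sequence -/

section

open IsLocalRing

/-- An element of `𝔪` outside `𝔪 ^ 2` is part of a minimal system of generators of `𝔪`. -/
theorem exists_span_insert_eq_maximalIdeal {Q : Type*} [CommRing Q] [IsLocalRing Q]
    [IsNoetherianRing Q] {x : Q} (hx : x ∈ maximalIdeal Q) (hx2 : x ∉ maximalIdeal Q ^ 2) :
    ∃ s : Set Q, s.Finite ∧ s.ncard + 1 ≤ (maximalIdeal Q).spanFinrank ∧
      Ideal.span (insert x s) = maximalIdeal Q := by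
  let k := ResidueField Q
  let v : CotangentSpace Q := (maximalIdeal Q).toCotangent ⟨x, hx⟩
  have hv : v ≠ 0 := fun h => hx2 (((maximalIdeal Q).toCotangent_eq_zero ⟨x, hx⟩).1 h)
  let W := CotangentSpace Q ⧸ Submodule.span k {v}
  have hW : Module.finrank k W + 1 = Module.finrank k (CotangentSpace Q) := by
    rw [← finrank_span_singleton (K := k) hv]
    exact Submodule.finrank_quotient_add_finrank _
  -- Lifting a basis of the cotangent space modulo `v` costs one generator fewer than the full
  -- count; together with `x` the lifts generate `𝔪` by Nakayama.
  let b := Module.finBasis k W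
  have hsurj : Function.Surjective fun y : maximalIdeal Q =>
      (Submodule.span k {v}).mkQ ((maximalIdeal Q).toCotangent y) :=
    (Submodule.mkQ_surjective _).comp (maximalIdeal Q).toCotangent_surjective
  choose y hy using fun i => hsurj (b i)
  have htop : Submodule.span k ((maximalIdeal Q).toCotangent ''
      (insert ⟨x, hx⟩ (Set.range y))) = (⊤ : Submodule k (CotangentSpace Q)) := by
    have hb : Submodule.map (Submodule.span k {v}).mkQ
        (Submodule.span k ((maximalIdeal Q).toCotangent '' Set.range y)) = ⊤ := by
      rw [Submodule.map_span, ← b.span_eq, ← Set.range_comp, ← Set.range_comp]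
      exact congrArg _ (congrArg _ (funext hy))
    rw [Set.image_insert_eq, Submodule.span_insert, ← Submodule.comap_map_mkQ]
    exact (congrArg _ hb).trans (Submodule.comap_top _)
  rw [CotangentSpace.span_image_eq_top_iff] at htop
  refine ⟨Set.range fun i => (y i : Q), Set.finite_range _, ?_, ?_⟩
  · rw [spanFinrank_maximalIdeal_eq_finrank_cotangentSpace, ← hW, ← Set.image_univ]
    refine Nat.succ_le_succ ((Set.ncard_image_le Set.finite_univ).trans ?_)
    rw [Set.ncard_univ, Nat.card_eq_fintype_card, Fintype.card_fin]
  · have := congrArg (Submodule.map (maximalIdeal Q).subtype) htop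
    rw [Submodule.map_span, Submodule.map_top, Submodule.range_subtype, Set.image_insert_eq,
      ← Set.range_comp] at this
    exact this

/-- By Nakayama, `𝔪 = 𝔪 ^ 2` forces `𝔪 = 0`. -/
theorem exists_mem_maximalIdeal_notMem_sq (Q : Type*) [CommRing Q] [IsLocalRing Q]
    [IsNoetherianRing Q] (h : ¬ IsField Q) : ¬ maximalIdeal Q ≤ maximalIdeal Q ^ 2 := by
  intro hle
  apply h
  rw [isField_iff_maximalIdeal_eq]
  refine Submodule.eq_bot_of_le_smul_of_le_jacobson_bot (maximalIdeal Q) _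
    (maximalIdeal Q).fg_of_isNoetherianRing ?_ (maximalIdeal_le_jacobson _)
  rwa [smul_eq_mul, ← sq]

/-- Dividing by `x` saves at least one generator of the maximal ideal, while the Krull dimension
drops by at most one. -/
theorem isRegularLocalRing_quotient_span_singleton {Q : Type*} [CommRing Q]
    [IsRegularLocalRing Q] {x : Q} (hx : x ∈ maximalIdeal Q) (hx2 : x ∉ maximalIdeal Q ^ 2) :
    ∃ _ : IsRegularLocalRing (Q ⧸ Ideal.span {x}),
      (maximalIdeal (Q ⧸ Ideal.span {x})).spanFinrank + 1 ≤ (maximalIdeal Q).spanFinrank := by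
  have hne : Ideal.span {x} ≠ ⊤ := fun h => by
    rw [Ideal.span_singleton_eq_top] at h
    exact hx h
  have : Nontrivial (Q ⧸ Ideal.span {x}) := Ideal.Quotient.nontrivial_iff.2 hne
  have : IsLocalRing (Q ⧸ Ideal.span {x}) :=
    IsLocalRing.of_surjective' (Ideal.Quotient.mk _) Ideal.Quotient.mk_surjective
  obtain ⟨s, hs, hcard, hspan⟩ := exists_span_insert_eq_maximalIdeal hx hx2
  have hmap : maximalIdeal (Q ⧸ Ideal.span {x}) =
      Ideal.span (Ideal.Quotient.mk (Ideal.span {x}) '' s) := by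
    have hmk : Ideal.Quotient.mk (Ideal.span {x}) x = 0 :=
      Ideal.Quotient.eq_zero_iff_mem.2 (Ideal.mem_span_singleton_self x)
    rw [← map_maximalIdeal_of_surjective _ Ideal.Quotient.mk_surjective, ← hspan, Ideal.map_span,
      Set.image_insert_eq, hmk]
    exact Submodule.span_insert_zero
  have hle : (maximalIdeal (Q ⧸ Ideal.span {x})).spanFinrank ≤ s.ncard := by
    rw [hmap]
    exact (Submodule.spanFinrank_span_le_ncard_of_finite (hs.image _)).trans
      (Set.ncard_image_le hs)
  have hdim : ringKrullDim Q ≤ ringKrullDim (Q ⧸ Ideal.span {x}) + (1 : ℕ) := by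
    have := ringKrullDim_le_ringKrullDim_quotient_add_encard {x} (R := Q)
      (by
      simpa [ringJacobson_eq_maximalIdeal] using hx)
    simpa using this
  refine ⟨IsRegularLocalRing.of_spanFinrank_maximalIdeal_le _ ?_, by omega⟩
  rw [← IsRegularLocalRing.spanFinrank_maximalIdeal] at hdim
  rw [← ENat.WithBot.add_le_add_natCast_right_iff (c := 1)]
  refine le_trans ?_ hdim
  exact_mod_cast (by omega)

/-- Induction on the number of generators of `𝔪`. For suitable `x`, the ideal `(x)` is prime and
contains a minimal prime `p` with `x ∉ p`; then `p = x p`, so `p = 0` by Nakayama. -/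
theorem isDomain_of_isRegularLocalRing (Q : Type*) [CommRing Q] [IsRegularLocalRing Q] :
    IsDomain Q := by
  induction hn : (maximalIdeal Q).spanFinrank using Nat.strong_induction_on generalizing Q with
  | _ n ih =>
  by_cases hQ : IsField Q
  · exact hQ.isDomain
  have hsq := exists_mem_maximalIdeal_notMem_sq Q hQ
  have hmin : ∀ p ∈ minimalPrimes Q, ¬ maximalIdeal Q ≤ p := by
    intro p hp hle
    have hpp : p.IsPrime := hp.1.1
    obtain rfl : p = maximalIdeal Q := le_antisymm (le_maximalIdeal hpp.ne_top) hle
    have h0 := IsRegularLocalRing.spanFinrank_maximalIdeal (R := Q)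
    rw [← maximalIdeal_height_eq_ringKrullDim, Ideal.height_eq_zero_iff.2 hp,
      spanFinrank_maximalIdeal_eq_finrank_cotangentSpace] at h0
    exact hQ (finrank_cotangentSpace_eq_zero_iff.1 (by exact_mod_cast h0))
  obtain ⟨x, hx, hx2, hxp⟩ : ∃ x ∈ maximalIdeal Q, x ∉ maximalIdeal Q ^ 2 ∧
      ∀ p ∈ minimalPrimes Q, x ∉ p := by
    have hfin := minimalPrimes.finite_of_isNoetherianRing Q
    by_contra! h
    classical
    -- Prime avoidance tolerates the non-prime ideal `𝔪 ^ 2` among the minimal primes.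
    obtain ⟨p, hp, hle⟩ := (Ideal.subset_union_prime (f := id)
      (s := insert (maximalIdeal Q ^ 2) hfin.toFinset) (maximalIdeal Q ^ 2) (maximalIdeal Q ^ 2)
      (fun p hp hne _ => by
        simp only [Finset.mem_insert, hne, Set.Finite.mem_toFinset, false_or] at hp
        exact hp.1.1) (I := maximalIdeal Q)).1 (fun x hx => by
          simp only [Set.mem_iUnion]
          by_cases hx2 : x ∈ maximalIdeal Q ^ 2
          · exact ⟨_, by simp, hx2⟩
          · obtain ⟨p, hp, hxp⟩ := h x hx hx2
            exact ⟨p, by simp [hp], hxp⟩)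
    rw [Finset.mem_insert, Set.Finite.mem_toFinset] at hp
    obtain rfl | hp := hp
    · exact hsq hle
    · exact hmin p hp hle
  obtain ⟨hreg, hlt⟩ := isRegularLocalRing_quotient_span_singleton hx hx2
  have hdom := ih _ (by omega) (Q ⧸ Ideal.span {x}) rfl
  have hprime : (Ideal.span {x}).IsPrime := (Ideal.Quotient.isDomain_iff_prime _).1 hdom
  obtain ⟨p, hp, hpx⟩ := Ideal.exists_minimalPrimes_le (bot_le : ⊥ ≤ Ideal.span {x})
  have hpp : p.IsPrime := hp.1.1
  have hp0 : p = ⊥ := by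
    refine Submodule.eq_bot_of_le_smul_of_le_jacobson_bot (maximalIdeal Q) p
      p.fg_of_isNoetherianRing ?_ (maximalIdeal_le_jacobson _)
    intro a ha
    obtain ⟨c, rfl⟩ := Ideal.mem_span_singleton'.1 (hpx ha)
    have hc := (hpp.mem_or_mem ha).resolve_right (hxp p hp)
    rw [mul_comm]
    exact Submodule.smul_mem_smul hx hc
  rw [hp0] at hpp
  exact IsDomain.of_bot_isPrime Q

open RingTheory.Sequence Pointwise in
-- Turns regularity of the tail on a `Q`-module into regularity over the ring `Q/(x)`, so that
-- inductions can change the ring.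
theorem isWeaklyRegular_ring_cons_iff {Q : Type*} [CommRing Q] (x : Q) (xs : List Q) :
    IsWeaklyRegular Q (x :: xs) ↔ IsSMulRegular Q x ∧
      IsWeaklyRegular (Q ⧸ Ideal.span {x}) (xs.map (Ideal.Quotient.mk (Ideal.span {x}))) := by
  rw [isWeaklyRegular_cons_iff]
  refine and_congr_right' ?_
  let e : QuotSMulTop x Q ≃ₗ[Q] Q ⧸ Ideal.span {x} :=
    Submodule.quotEquivOfEq _ _ (by
      rw [← Submodule.ideal_span_singleton_smul, smul_eq_mul, Ideal.mul_top])
  exact (e.isWeaklyRegular_congr xs).trans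
    (isWeaklyRegular_map_algebraMap_iff (Q ⧸ Ideal.span {x}) _ xs).symm

open RingTheory.Sequence in
/-- The maximal ideal of a regular local ring is generated by a regular sequence. -/
theorem exists_isWeaklyRegular_ofList_eq_maximalIdeal (Q : Type*) [CommRing Q]
    [IsRegularLocalRing Q] : ∃ xs : List Q, IsWeaklyRegular Q xs ∧
      Ideal.ofList xs = maximalIdeal Q ∧ xs.length ≤ (maximalIdeal Q).spanFinrank := by
  induction hn : (maximalIdeal Q).spanFinrank using Nat.strong_induction_on generalizing Q with
  | _ n ih =>
  by_cases hQ : IsField Q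
  · refine ⟨[], .nil _ _, ?_, by simp⟩
    rw [Ideal.ofList_nil, isField_iff_maximalIdeal_eq.1 hQ]
  obtain ⟨x, hx, hx2⟩ := SetLike.not_le_iff_exists.1 (exists_mem_maximalIdeal_notMem_sq Q hQ)
  obtain ⟨hreg, hlt⟩ := isRegularLocalRing_quotient_span_singleton hx hx2
  obtain ⟨ys, hys, hspan, hlen⟩ := ih _ (by omega) (Q ⧸ Ideal.span {x}) rfl
  obtain ⟨zs, rfl⟩ := List.map_surjective_iff.2
    (Ideal.Quotient.mk_surjective (I := Ideal.span {x})) ys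
  have := isDomain_of_isRegularLocalRing Q
  have hx0 : x ≠ 0 := fun h => hx2 (h ▸ Ideal.zero_mem _)
  refine ⟨x :: zs, (isWeaklyRegular_ring_cons_iff _ _).2 ⟨fun a b h => mul_left_cancel₀ hx0 h, hys⟩,
    ?_, ?_⟩
  · rw [Ideal.ofList_cons, ← Ideal.comap_map_quotientMk, Ideal.map_ofList, hspan]
    have := IsLocalHom.of_surjective (Ideal.Quotient.mk (Ideal.span {x}))
      Ideal.Quotient.mk_surjective
    exact maximalIdeal_comap _
  · rw [List.length_map] at hlen
    rw [List.length_cons]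
    omega

end

/-! ### Projective dimension over a regular local ring -/

section

open IsLocalRing RingTheory.Sequence

/-- A syzygy of a module on which `xs` is weakly regular has one more weakly regular element. -/
theorem isWeaklyRegular_append_singleton_of_exact {R L F K : Type*} [CommRing R] [AddCommGroup L]
    [AddCommGroup F] [AddCommGroup K] [Module R L] [Module R F] [Module R K] {i : L →ₗ[R] F}
    {p : F →ₗ[R] K} (hi : Function.Injective i) (hip : Function.Exact i p)
    (hp : Function.Surjective p) {xs : List R} {y : R} (hK : IsWeaklyRegular K xs)
    (hF : IsWeaklyRegular F (xs ++ [y])) : IsWeaklyRegular L (xs ++ [y]) := by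
  have reg : ∀ {z : R}, IsSMulRegular F z → IsSMulRegular L z := fun {z} hz a b h => by
    apply hi
    apply hz
    simpa using congrArg i h
  induction hK generalizing L F with
  | nil =>
    rw [List.nil_append, isWeaklyRegular_singleton_iff] at hF ⊢
    exact reg hF
  | @cons K _ _ x xs hx _ ih =>
    rw [List.cons_append, isWeaklyRegular_cons_iff] at hF ⊢
    -- Regularity of `x` on `K` keeps `0 → L → F → K → 0` exact modulo `x`.
    have hinj : Function.Injective (QuotSMulTop.map x i) := by
      rw [injective_iff_map_eq_zero]
      intro l hl
      obtain ⟨l, rfl⟩ := Submodule.Quotient.mk_surjective _ l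
      rw [QuotSMulTop.map_apply_mk, quotSMulTop_mk_eq_zero_iff] at hl
      obtain ⟨a, ha⟩ := hl
      have hpa : p a = 0 := hx (by
        simp only [smul_zero]
        rw [← map_smul, ha, hip.apply_apply_eq_zero])
      obtain ⟨l', rfl⟩ := (hip a).1 hpa
      rw [quotSMulTop_mk_eq_zero_iff]
      exact ⟨l', hi (by rw [map_smul, ha])⟩
    refine ⟨reg hF.1, ih hinj (QuotSMulTop.map_exact x hip hp) (QuotSMulTop.map_surjective x hp)
      hF.2 fun {z} hz a b h => ?_⟩
    apply hinj
    apply hz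
    simpa using congrArg (QuotSMulTop.map x i) h

theorem tensorProductMk_eq_zero_iff {R A : Type*} [CommRing R] [IsLocalRing R] [AddCommGroup A]
    [Module R A] (a : A) :
    TensorProduct.mk R (ResidueField R) A 1 a = 0 ↔ a ∈ maximalIdeal R • (⊤ : Submodule R A) := by
  rw [← LinearMap.ker_tensorProductMk]
  rfl

/-- A finite module is free if the maximal ideal is generated by a weakly regular sequence on it. -/
theorem free_of_isWeaklyRegular {R K : Type*} [CommRing R] [IsLocalRing R] [IsNoetherianRing R]
    [AddCommGroup K] [Module R K] [Module.Finite R K] {xs : List R}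
    (hxs : Ideal.ofList xs = maximalIdeal R) (hK : IsWeaklyRegular K xs) : Module.Free R K := by
  obtain ⟨n, p, hp⟩ := Module.Finite.exists_fin' R K
  let i := (LinearMap.ker p).subtype
  have hip : Function.Exact i p := LinearMap.exact_subtype_ker_map p
  have h0 : Function.Exact (0 : PUnit →ₗ[R] LinearMap.ker p) i := fun a => by
    simp [i, eq_comm]
  -- Weak regularity on `K` keeps `ker p → R ^ n` injective modulo `(xs) = 𝔪`, that is, after
  -- tensoring with the residue field; this is the criterion for freeness.
  have hex := map_first_exact_on_four_term_right_exact_of_isSMulRegular_last h0 hip hp hK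
  refine Module.free_of_lTensor_residueField_injective i p hp hip ?_
  rw [injective_iff_map_eq_zero]
  intro t ht
  obtain ⟨l, rfl⟩ := TensorProduct.mk_surjective R (LinearMap.ker p) (ResidueField R)
    residue_surjective t
  rw [tensorProductMk_eq_zero_iff, ← hxs, ← Submodule.Quotient.mk_eq_zero]
  have hl : TensorProduct.mk R (ResidueField R) (Fin n → R) 1 (i l) = 0 := ht
  rw [tensorProductMk_eq_zero_iff, ← hxs, ← Submodule.Quotient.mk_eq_zero] at hl
  obtain ⟨z, hz⟩ := (hex (Submodule.Quotient.mk l)).1 hl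
  obtain ⟨z, rfl⟩ := Submodule.Quotient.mk_surjective _ z
  rw [← hz]
  exact Submodule.Quotient.mk_zero _

theorem isWeaklyRegular_of_flat {R F : Type*} [CommRing R] [AddCommGroup F] [Module R F]
    [Module.Flat R F] {xs : List R} (h : IsWeaklyRegular R xs) : IsWeaklyRegular F xs :=
  ((TensorProduct.lid R F).isWeaklyRegular_congr xs).1 h.isWeaklyRegular_rTensor

/-- The projective dimension of a finite module is bounded by the number of elements that a weakly
regular sequence generating the maximal ideal has beyond an initial segment which is weakly regular
on the module. -/
theorem hasProjectiveDimensionLE_of_isWeaklyRegular_take {R : Type u} [CommRing R] [IsLocalRing R]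
    [IsNoetherianRing R] {xs : List R} (hxs : Ideal.ofList xs = maximalIdeal R)
    (hR : IsWeaklyRegular R xs) (n : ℕ) (M : ModuleCat.{u} R) [Module.Finite R M]
    (hM : IsWeaklyRegular M (xs.take (xs.length - n))) : HasProjectiveDimensionLE M n := by
  induction n generalizing M with
  | zero =>
    rw [Nat.sub_zero, List.take_length] at hM
    have := free_of_isWeaklyRegular hxs hM
    have : Projective M := (IsProjective.iff_projective M).1 Module.Projective.of_free
    exact (projective_iff_hasProjectiveDimensionLE_zero _).1 this
  | succ n ih =>
    obtain ⟨m, p, hp⟩ := Module.Finite.exists_fin' R M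
    have hS := LinearMap.shortExact_shortComplexKer hp
    have hproj : Projective (ModuleCat.of R (Fin m → R)) :=
      (IsProjective.iff_projective _).1 (inferInstanceAs (Module.Projective R (Fin m → R)))
    refine (hS.hasProjectiveDimensionLT_X₃_iff n hproj).2 (ih (ModuleCat.of R (LinearMap.ker p)) ?_)
    -- Once `n` reaches the length, the truncated subtraction leaves the empty sequence and nothing
    -- is required.
    by_cases hn : n < xs.length
    · have hlen : xs.length - n = xs.length - (n + 1) + 1 := by omega
      have htake := List.take_concat_get' xs (xs.length - (n + 1)) (by omega)
      have hRt : IsWeaklyRegular R (xs.take (xs.length - (n + 1) + 1)) := by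
        rw [← List.take_append_drop (xs.length - (n + 1) + 1) xs, isWeaklyRegular_append_iff] at hR
        exact hR.1
      rw [← htake] at hRt
      rw [hlen, ← htake]
      exact isWeaklyRegular_append_singleton_of_exact (Submodule.subtype_injective _)
        (LinearMap.exact_subtype_ker_map p) hp hM (isWeaklyRegular_of_flat hRt)
    · rw [Nat.sub_eq_zero_of_le (by omega), List.take_zero]
      exact .nil _ _

/-- Finite modules over a regular local ring have projective dimension at most the minimal number of
generators of the maximal ideal. -/
theorem projectiveDimension_le_spanFinrank_maximalIdeal (R : Type u) [CommRing R]
    [IsRegularLocalRing R] (M : ModuleCat.{u} R) [Module.Finite R M] :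
    projectiveDimension M ≤ (maximalIdeal R).spanFinrank := by
  obtain ⟨xs, hxs, hspan, hlen⟩ := exists_isWeaklyRegular_ofList_eq_maximalIdeal R
  rw [projectiveDimension_le_iff]
  refine hasProjectiveDimensionLE_of_isWeaklyRegular_take hspan hxs _ M ?_
  rw [Nat.sub_eq_zero_of_le hlen, List.take_zero]
  exact .nil _ _

end

/-! ### The bound by the embedding dimension -/

section

open IsLocalRing RingTheory.Sequence

/-- Passing to the quotient by an ideal contained in `𝔪 ^ 2` does not decrease the embedding
dimension. -/
theorem spanFinrank_maximalIdeal_le_edim {Q R : Type*} [CommRing Q] [IsLocalRing Q]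
    [IsNoetherianRing Q] [CommRing R] [IsLocalRing R] {f : Q →+* R} (hf : Function.Surjective f)
    (hker : RingHom.ker f ≤ maximalIdeal Q ^ 2) : (maximalIdeal Q).spanFinrank ≤ edim R := by
  have : IsNoetherianRing R := isNoetherianRing_of_surjective Q R f hf
  have hfg := (maximalIdeal R).fg_of_isNoetherianRing
  have hfin : (maximalIdeal R).generators.Finite := Submodule.FG.finite_generators hfg
  have hloc := IsLocalHom.of_surjective f hf
  rw [edim, ← spanFinrank_maximalIdeal_eq_finrank_cotangentSpace,
    ← Submodule.FG.generators_ncard hfg]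
  -- Lifts of minimal generators of `𝔪_R` generate `𝔪_Q` modulo `ker f ≤ 𝔪_Q ^ 2`, hence generate it
  -- by Nakayama.
  let t := Function.surjInv hf '' (maximalIdeal R).generators
  have hft : f '' t = (maximalIdeal R).generators := by
    rw [← Set.image_comp, Function.comp_surjInv, Set.image_id]
  have hmap : (Ideal.span t).map f = maximalIdeal R := by
    rw [Ideal.map_span, hft]
    exact (maximalIdeal R).span_generators
  have hcomap : maximalIdeal Q = Ideal.span t ⊔ RingHom.ker f := by
    rw [← Ideal.comap_map_of_surjective' f hf, hmap]
    exact (maximalIdeal_comap f).symm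
  have hspan : Ideal.span t = maximalIdeal Q := by
    refine le_antisymm (hcomap ▸ le_sup_left) ?_
    refine Submodule.le_of_le_smul_of_le_jacobson_bot (I := maximalIdeal Q)
      (maximalIdeal Q).fg_of_isNoetherianRing (maximalIdeal_le_jacobson _) ?_
    rw [smul_eq_mul, ← sq]
    exact hcomap.le.trans (sup_le_sup_left hker _)
  rw [← hspan]
  exact (Submodule.spanFinrank_span_le_ncard_of_finite (hfin.image _)).trans
    (Set.ncard_image_le hfin)

theorem qpd_le_edim_of_ker_le_sq {Q R : Type u} [CommRing Q] [IsRegularLocalRing Q] [CommRing R]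
    [IsLocalRing R] {x : List Q} (hx : IsWeaklyRegular Q x) {f : Q →+* R}
    (hf : Function.Surjective f) (hker : RingHom.ker f = Ideal.ofList x)
    (hsq : RingHom.ker f ≤ maximalIdeal Q ^ 2) (M : ModuleCat.{u} R) [Module.Finite R M] :
    qpd M ≤ (edim R : WithBot ℕ∞) := by
  have : Module.Finite Q ((ModuleCat.restrictScalars f).obj M) := by
    algebraize [f]
    let N := (ModuleCat.restrictScalars f).obj M
    let : Module R N := inferInstanceAs (Module R M)
    have : IsScalarTower Q R N := ⟨fun q r m => mul_smul (f q) r (show M from m)⟩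
    have : Module.Finite Q R := Module.Finite.of_surjective (Algebra.linearMap Q R) hf
    have : Module.Finite R N := inferInstanceAs (Module.Finite R M)
    exact Module.Finite.trans R N
  refine (qpd_le_projectiveDimension hx hf hker M).trans
    ((projectiveDimension_le_spanFinrank_maximalIdeal Q _).trans ?_)
  exact_mod_cast spanFinrank_maximalIdeal_le_edim hf hsq

/-- The bound concerns only `R` and `M`, so the presenting ring may be changed: induct on the length
of the sequence, dividing `Q` by a member outside `𝔪_Q ^ 2` until the kernel lies in `𝔪_Q ^ 2`. -/
theorem qpd_le_edim {Q R : Type u} [CommRing Q] [IsRegularLocalRing Q] [CommRing R] [IsLocalRing R]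
    {x : List Q} (hx : IsWeaklyRegular Q x) {f : Q →+* R} (hf : Function.Surjective f)
    (hker : RingHom.ker f = Ideal.ofList x) (M : ModuleCat.{u} R) [Module.Finite R M] :
    qpd M ≤ (edim R : WithBot ℕ∞) := by
  induction hn : x.length generalizing Q with
  | zero =>
    obtain rfl := List.length_eq_zero_iff.1 hn
    exact qpd_le_edim_of_ker_le_sq hx hf hker (by rw [hker, Ideal.ofList_nil]; exact bot_le) M
  | succ n ih =>
  have hle : RingHom.ker f ≤ maximalIdeal Q := le_maximalIdeal (RingHom.ker_ne_top f)
  have hmem : ∀ y ∈ x, y ∈ maximalIdeal Q := fun y hy =>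
    hle (hker ▸ Ideal.subset_span hy)
  by_cases hsq : RingHom.ker f ≤ maximalIdeal Q ^ 2
  · exact qpd_le_edim_of_ker_le_sq hx hf hker hsq M
  obtain ⟨y, hy, hy2⟩ : ∃ y ∈ x, y ∉ maximalIdeal Q ^ 2 := by
    by_contra! h
    rw [hker] at hsq
    exact hsq (Ideal.span_le.2 h)
  classical
  -- A regular sequence in the maximal ideal of a Noetherian local ring may be permuted, so `y` can
  -- be moved to the front.
  have hperm := List.perm_cons_erase hy
  have hx' := isWeaklyRegular_of_perm_of_subset_maximalIdeal hx hperm hmem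
  rw [isWeaklyRegular_ring_cons_iff] at hx'
  obtain ⟨hreg, -⟩ := isRegularLocalRing_quotient_span_singleton (hmem y hy) hy2
  have hspan : Ideal.ofList x = Ideal.ofList (y :: x.erase y) :=
    congrArg Ideal.span (Set.ext fun _ => hperm.mem_iff)
  have hlift : ∀ a ∈ Ideal.span {y}, f a = 0 := fun a ha => by
    rw [← RingHom.mem_ker, hker, hspan, Ideal.ofList_cons]
    exact Ideal.mem_sup_left ha
  refine ih hx'.2 (f := Ideal.Quotient.lift (Ideal.span {y}) f hlift)
    (Ideal.Quotient.lift_surjective_of_surjective _ _ hf) ?_ ?_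
  · refine (Ideal.ker_quotient_lift f hlift).trans ?_
    rw [hker, hspan, Ideal.map_ofList, List.map_cons, Ideal.ofList_cons,
      Ideal.Quotient.eq_zero_iff_mem.2 (Ideal.mem_span_singleton_self y),
      Ideal.span_singleton_zero, bot_sup_eq]
  · rw [List.length_map, List.length_erase_of_mem hy, hn, Nat.add_sub_cancel]

end

end QuasiProjective

end

theorem corollary3p8 {Q R : Type u} [CommRing Q] [IsNoetherianRing Q] [CommRing R]
    (x : List Q) (hx : RingTheory.Sequence.IsRegular Q x)
    (f : Q →+* R) (hf : Function.Surjective f) (hker : RingHom.ker f = Ideal.ofList x)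
    (M : ModuleCat.{u} R) :
    (∀ P : ChainComplex (ModuleCat.{u} Q) ℤ,
      QuasiProjective.IsProjectiveResolution ((ModuleCat.restrictScalars f).obj M) P →
        QuasiProjective.IsQuasiProjectiveResolution M (QuasiProjective.baseChange f P)) ∧
    QuasiProjective.qpd M ≤ projectiveDimension ((ModuleCat.restrictScalars f).obj M) ∧
    (∀ [IsRegularLocalRing Q] [IsLocalRing R] [Module.Finite R M],
      QuasiProjective.qpd M ≤ (QuasiProjective.edim R : WithBot ℕ∞) ∧
        QuasiProjective.qpd M < ⊤) := by
  refine ⟨fun P hP => hP.isQuasiProjectiveResolution_baseChange hx.toIsWeaklyRegular hf hker,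
    QuasiProjective.qpd_le_projectiveDimension hx.toIsWeaklyRegular hf hker M, ?_⟩
  intro _ _ _
  have h := QuasiProjective.qpd_le_edim hx.toIsWeaklyRegular hf hker M
  exact ⟨h, h.trans_lt (WithBot.coe_lt_coe.2 (ENat.natCast_lt_top _))⟩
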